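/- Let $\Omega\subset\mathbb{R}^N$ ($N\ge 1$) be a bounded domain with boundary of class $C^2$ and outward unit normal $n$, let $p\in(1,\infty)$, let $u_0\in C(\overline\Omega)$ with $\int_\Omega u_0=0$, and let $T_0\in(0,\infty)$. For $N<q<\infty$ let $D^q$ be the set of $v\in C(\overline\Omega)\cap W^{2,q}(\Omega)$ with $\Delta v\in C(\overline\Omega)$ and $\partial v/\partial n=0$ on $\partial\Omega$ (the functions of $W^{2,q}(\Omega)$, $q>N$, being $C^1$ up to the boundary), and let $D=\bigcup_{N<q<\infty}D^q$, with the norm $\|v\|_\infty+\|\Delta v\|_\infty$. Let $$u\in C\big([0,T_0);C(\overline\Omega)\big)\cap C^1\big((0,T_0);C(\overline\Omega)\big)\cap C\big((0,T_0);D\big)$$ be a solution of $$u_t-\Delta u=|u|^p-\frac1{|\Omega|}\int_\Omega|u|^p\ \text{ in }\Omega\times(0,T_0),\qquad \frac{\partial u}{\partial n}=0\ \text{ on }\partial\Omega\times(0,T_0),\qquad u(0)=u_0 .$$ For $t\in(0,T_0)$ let $$E(u(t))=\int_\Omega\Big(\frac12|\nabla u(t)|^2-\frac1{p+1}\,u(t)|u(t)|^p\Big)\,dx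 .$$ If there is a constant $C_0>0$ such that $E(u(t))\ge -C_0$ for all $t\in(0,T_0)$, then there is a constant $C>0$ such that $\|u(t)\|_{L^2(\Omega)}\le C$ for all $t\in[0,T_0)$. -/

import Mathlib

open MeasureTheory Set

noncomputable section

namespace NonlocalHeat

/-- `Ω ∩ U` is the sublevel set `{ρ < 0}` in `U`, where `U` is an open neighbourhood of `x` and
`ρ` is of class `C²` on `U` with non-vanishing gradient. -/
structure IsLocalDefiningFunction {N : ℕ} (Ω : Set (EuclideanSpace ℝ (Fin N)))
    (x : EuclideanSpace ℝ (Fin N)) (U : Set (EuclideanSpace ℝ (Fin N)))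
    (ρ : EuclideanSpace ℝ (Fin N) → ℝ) : Prop where
  isOpen : IsOpen U
  mem : x ∈ U
  contDiffOn : ContDiffOn ℝ 2 ρ U
  gradient_ne_zero : ∀ y ∈ U, gradient ρ y ≠ 0
  mem_iff : ∀ y ∈ U, y ∈ Ω ↔ ρ y < 0

/-- A bounded domain (non-empty connected open set) of `ℝᴺ` with boundary of class `C²`: near each
boundary point the domain lies on one side of a regular `C²` hypersurface. -/
structure C2Domain (N : ℕ) where
  carrier : Set (EuclideanSpace ℝ (Fin N))
  isOpen : IsOpen carrier
  isConnected : IsConnected carrier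
  isBounded : Bornology.IsBounded carrier
  c2_boundary : ∀ x ∈ frontier carrier, ∃ U ρ, IsLocalDefiningFunction carrier x U ρ

variable {N : ℕ}

instance (Ω : C2Domain N) : CompactSpace (closure Ω.carrier) :=
  isCompact_iff_compactSpace.mp Ω.isBounded.isCompact_closure

/-- The space of continuous functions on the closure of `Ω`; as the closure is compact, it carries
the supremum norm. -/
abbrev CBar (Ω : C2Domain N) : Type := C(closure Ω.carrier, ℝ)

/-- A function on the closure of `Ω`, viewed as a function on `ℝᴺ` that is `0` elsewhere (only its
values on the closure of `Ω` are ever used). -/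
def ext {Ω : C2Domain N} (v : CBar Ω) : EuclideanSpace ℝ (Fin N) → ℝ :=
  Function.extend Subtype.val v 0

/-- The outward unit normal vector to the boundary at `x`, i.e. the normalized gradient at `x`
of a local defining function. -/
def IsOutwardUnitNormal (Ω : C2Domain N) (x n : EuclideanSpace ℝ (Fin N)) : Prop :=
  ∃ U ρ, IsLocalDefiningFunction Ω.carrier x U ρ ∧ n = ‖gradient ρ x‖⁻¹ • gradient ρ x

/-- Test functions: smooth functions with compact support contained in `Ω`. -/
structure IsTestFunction (Ω : C2Domain N) (φ : EuclideanSpace ℝ (Fin N) → ℝ) : Prop where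
  contDiff : ContDiff ℝ (⊤ : ℕ∞) φ
  hasCompactSupport : HasCompactSupport φ
  tsupport_subset : tsupport φ ⊆ Ω.carrier

/-- `g` is the weak partial derivative `∂f/∂xᵢ` on `Ω`. -/
structure HasWeakPartial (Ω : C2Domain N) (i : Fin N)
    (f g : EuclideanSpace ℝ (Fin N) → ℝ) : Prop where
  locallyIntegrableOn : LocallyIntegrableOn f Ω.carrier
  locallyIntegrableOn' : LocallyIntegrableOn g Ω.carrier
  integral_eq : ∀ φ, IsTestFunction Ω φ →
    ∫ x in Ω.carrier, f x * fderiv ℝ φ x (EuclideanSpace.single i 1)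
      = -∫ x in Ω.carrier, g x * φ x

/-- The Sobolev space `W^{2,q}(Ω)` of functions whose weak derivatives of order at most two exist
and lie in `L^q(Ω)`. -/
def MemW2 (Ω : C2Domain N) (q : ℝ) (f : EuclideanSpace ℝ (Fin N) → ℝ) : Prop :=
  ∃ (d : Fin N → EuclideanSpace ℝ (Fin N) → ℝ)
    (h : Fin N → Fin N → EuclideanSpace ℝ (Fin N) → ℝ),
    MemLp f (ENNReal.ofReal q) (volume.restrict Ω.carrier) ∧
    (∀ i, MemLp (d i) (ENNReal.ofReal q) (volume.restrict Ω.carrier) ∧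
      HasWeakPartial Ω i f (d i)) ∧
    (∀ i j, MemLp (h i j) (ENNReal.ofReal q) (volume.restrict Ω.carrier) ∧
      HasWeakPartial Ω j (d i) (h i j))

/-- `g` is the Laplacian of `f` on `Ω` in the sense of distributions. -/
def HasWeakLaplacian (Ω : C2Domain N) (f g : EuclideanSpace ℝ (Fin N) → ℝ) : Prop :=
  ∀ φ, IsTestFunction Ω φ →
    ∫ x in Ω.carrier, f x * Laplacian.laplacian φ x = ∫ x in Ω.carrier, g x * φ x

/-- The Neumann condition `∂f/∂n = 0` on the boundary, for a function that is `C¹` up to the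
boundary (as every function of `W^{2,q}(Ω)` with `q > N` is): the gradient of `f` in `Ω` extends
continuously to the closure of `Ω`, and on the boundary it is orthogonal to the normal. -/
def NeumannCondition (Ω : C2Domain N) (f : EuclideanSpace ℝ (Fin N) → ℝ) : Prop :=
  ∃ G : EuclideanSpace ℝ (Fin N) → EuclideanSpace ℝ (Fin N),
    ContinuousOn G (closure Ω.carrier) ∧
    (∀ x ∈ Ω.carrier, HasGradientAt f (G x) x) ∧
    ∀ x ∈ frontier Ω.carrier, ∀ n, IsOutwardUnitNormal Ω x n → inner ℝ (G x) n = 0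

/-- `v` belongs to the domain `D = ⋃_{N < q < ∞} D^q` of the Neumann Laplacian in the space of
continuous functions on the closure of `Ω`, and `Δ v = w`. Here `D^q` is the set of the
`v ∈ C(closure Ω)` with `v ∈ W^{2,q}(Ω)`, `Δ v ∈ C(closure Ω)` and `∂v/∂n = 0` on the boundary. -/
def IsNeumannLaplacian (Ω : C2Domain N) (v w : CBar Ω) : Prop :=
  ∃ q : ℝ, (N : ℝ) < q ∧ MemW2 Ω q (ext v) ∧ HasWeakLaplacian Ω (ext v) (ext w) ∧
    NeumannCondition Ω (ext v)

/-- `u` is a solution on the time interval `[0, T)` of `u_t - Δu = |u|^p - ⨍_Ω |u|^p` in `Ω`,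
`∂u/∂n = 0` on the boundary, `u(0) = u₀`, where `∫_Ω u₀ = 0`, in the class
`C([0,T); C(closure Ω)) ∩ C¹((0,T); C(closure Ω)) ∩ C((0,T); D)`,
the domain `D` being equipped with the graph norm `‖v‖_∞ + ‖Δ v‖_∞`. -/
structure IsSolution (Ω : C2Domain N) (p : ℝ) (u₀ : CBar Ω) (T : ℝ) (u : ℝ → CBar Ω) : Prop where
  integral_init : ∫ x in Ω.carrier, ext u₀ x = 0
  init : u 0 = u₀
  continuousOn : ContinuousOn u (Ico 0 T)
  contDiffOn : ContDiffOn ℝ 1 u (Ioo 0 T)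
  equation : ∃ L : ℝ → CBar Ω, ContinuousOn L (Ioo 0 T) ∧
    ∀ t ∈ Ioo 0 T, IsNeumannLaplacian Ω (u t) (L t) ∧
      ∀ x ∈ Ω.carrier, ext (deriv u t) x - ext (L t) x
        = |ext (u t) x| ^ p - ⨍ y in Ω.carrier, |ext (u t) y| ^ p

/-- The energy `E(v) = ∫_Ω (1/2) |∇v|² - (1/(p+1)) v |v|^p` of a function that is `C¹` up to the
boundary. -/
def energy (Ω : C2Domain N) (p : ℝ) (v : CBar Ω) : ℝ :=
  ∫ x in Ω.carrier, ((1 / 2) * ‖gradient (ext v) x‖ ^ 2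
    - (1 / (p + 1)) * (ext v x * |ext v x| ^ p))

end NonlocalHeat

end

/-!
# An `L²` bound for a non-local heat equation whose energy is bounded below

Along a solution the energy dissipates according to `d/dt E(u(t)) = -∫ u_t²`. Put `y = ∫ u²`. Then
`y' = 2 ∫ u u_t ≤ ∫ u² + ∫ u_t² = y - E'`, so that `z = y + E + C₀`, which dominates `y` because the
energy is at least `-C₀`, satisfies `z' ≤ z`. Hence `exp(-t) z(t)` decreases on `(0, T₀)`, which
bounds `y` on `[T₀/2, T₀)`; on `[0, T₀/2]` it is bounded by continuity.

The energy identity (`IsSolution.hasDerivAt_energy`) rests on Green's identity (`green_identity`)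
for functions in the domain of the Neumann Laplacian. It gives
`∫ |∇a|² - ∫ |∇b|² = -∫ (a - b) (Δa + Δb)`, and letting `a = u(s)`, `b = u(t)`, `s → t`, it shows
that the Dirichlet integral of `u` is differentiable in time, although `∇u_t` need not exist. With
the test function `1` it gives `∫ Δu = 0`, hence `∫ u_t = 0`, so that the average in the equation
does not contribute.

Green's identity is proved without surface integrals, since its boundary term is zero. The weak
formulation is first extended to compactly supported `C¹` test functions (`integral_fderiv_test_eq`).
After localization by a partition of unity, a test function `ψ φ` supported near a boundary point is
multiplied by a cut-off `χ(-ρ/ε)`, where `ρ` is a local defining function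
(`greenFor_boundary`). The error is the integral of `ψ φ ⟨∇v, ∇(χ(-ρ/ε))⟩`. Here `⟨∇v, ∇ρ⟩` tends to
zero at the boundary by the Neumann condition, and `∇(χ(-ρ/ε))` is bounded in `L¹`
independently of `ε`: as `ρ` is `C²`, it can be integrated by parts against the `C¹` field `ψ ∇ρ`
(`exists_integral_deriv_transition_le`).
-/

namespace NonlocalHeat

open Filter Topology

variable {N : ℕ}

/-! ### Integration by parts and the weak formulation -/

lemma contDiff_of_contDiffAt_tsupport {E F : Type*} [NormedAddCommGroup E] [NormedSpace ℝ E]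
    [NormedAddCommGroup F] [NormedSpace ℝ F] {n : WithTop ℕ∞} {f : E → F}
    (h : ∀ x ∈ tsupport f, ContDiffAt ℝ n f x) : ContDiff ℝ n f := by
  rw [contDiff_iff_contDiffAt]
  intro x
  by_cases hx : x ∈ tsupport f
  · exact h x hx
  · exact contDiffAt_const.congr_of_eventuallyEq (notMem_tsupport_iff_eventuallyEq.mp hx)

/-- A compactly supported `C¹` function is a `C¹`-limit of smooth functions whose supports stay in
a given neighbourhood of its support. -/
lemma exists_contDiff_approx {Ω : Set (EuclideanSpace ℝ (Fin N))} (hΩ : IsOpen Ω)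
    {θ : EuclideanSpace ℝ (Fin N) → ℝ} (hθ : ContDiff ℝ 1 θ) (hc : HasCompactSupport θ)
    (hsub : tsupport θ ⊆ Ω) {ε : ℝ} (hε : 0 < ε) :
    ∃ φ : EuclideanSpace ℝ (Fin N) → ℝ, ContDiff ℝ (⊤ : ℕ∞) φ ∧ HasCompactSupport φ ∧
      tsupport φ ⊆ Ω ∧ ∀ x, |φ x - θ x| ≤ ε ∧ ∀ v, |fderiv ℝ φ x v - fderiv ℝ θ x v| ≤ ε * ‖v‖ := by
  obtain ⟨δ₀, hδ₀, hthick⟩ := hc.isCompact.exists_cthickening_subset_open hΩ hsub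
  have hcont' : Continuous (fderiv ℝ θ) := hθ.continuous_fderiv one_ne_zero
  obtain ⟨δ₁, hδ₁, h₁⟩ := Metric.uniformContinuous_iff.mp
    (hc.uniformContinuous_of_continuous hθ.continuous) ε hε
  obtain ⟨δ₂, hδ₂, h₂⟩ := Metric.uniformContinuous_iff.mp
    ((hc.fderiv ℝ).uniformContinuous_of_continuous hcont') ε hε
  set r : ℝ := min δ₀ (min δ₁ δ₂) with hr
  have hrpos : 0 < r := by positivity
  let b : ContDiffBump (0 : EuclideanSpace ℝ (Fin N)) := ⟨r / 2, r, by positivity, by linarith⟩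
  have hbl : LocallyIntegrable (b.normed volume) (volume : Measure (EuclideanSpace ℝ (Fin N))) :=
    b.continuous_normed.locallyIntegrable
  refine ⟨convolution (b.normed volume) θ (ContinuousLinearMap.lsmul ℝ ℝ) volume, ?_, ?_, ?_, ?_⟩
  · exact b.hasCompactSupport_normed.contDiff_convolution_left _ b.contDiff_normed
      hθ.continuous.locallyIntegrable
  · exact b.hasCompactSupport_normed.convolution _ hc
  · refine (closure_minimal ?_ Metric.isClosed_cthickening).trans hthick
    intro x hx
    obtain ⟨y, hy, z, hz, rfl⟩ := support_convolution_subset _ hx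
    rw [b.support_normed_eq, mem_ball_zero_iff] at hy
    refine Metric.mem_cthickening_of_dist_le _ z _ _ (subset_tsupport _ hz) ?_
    have : dist (y + z) z = ‖y‖ := by simp [dist_eq_norm]
    exact this.le.trans (hy.le.trans (min_le_left _ _))
  · intro x
    constructor
    · rw [← Real.dist_eq]
      refine b.dist_normed_convolution_le hθ.continuous.aestronglyMeasurable fun y hy => ?_
      exact (h₁ (lt_of_lt_of_le hy ((min_le_right _ _).trans (min_le_left _ _)))).le
    · intro v
      have hd := hc.hasFDerivAt_convolution_right (ContinuousLinearMap.lsmul ℝ ℝ) hbl hθ x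
      rw [hd.fderiv, convolution_precompR_apply _ hbl (hc.fderiv ℝ) hcont', ← Real.dist_eq]
      refine b.dist_normed_convolution_le (g := fun a => fderiv ℝ θ a v)
        (hcont'.clm_apply continuous_const).aestronglyMeasurable fun y hy => ?_
      have := h₂ (lt_of_lt_of_le hy ((min_le_right _ _).trans (min_le_right _ _)))
      rw [Real.dist_eq, ← sub_apply, ← Real.norm_eq_abs]
      rw [dist_eq_norm] at this
      exact (ContinuousLinearMap.le_opNorm _ _).trans
        (mul_le_mul_of_nonneg_right this.le (norm_nonneg _))

lemma integrable_of_continuousOn_of_isCompact {E : Type*} [TopologicalSpace E] [T2Space E]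
    [MeasurableSpace E] [OpensMeasurableSpace E]
    {μ : Measure E} [IsFiniteMeasureOnCompacts μ] {f : E → ℝ} {K : Set E} (hK : IsCompact K)
    (hf : ContinuousOn f K) (h0 : ∀ x ∉ K, f x = 0) : Integrable f μ := by
  rw [← integrableOn_iff_integrable_of_support_subset (s := K)]
  · exact hf.integrableOn_compact' hK hK.measurableSet
  · intro x hx
    by_contra h
    exact hx (h0 x h)

lemma apply_eq_sum_coord (L : EuclideanSpace ℝ (Fin N) →L[ℝ] ℝ) (v : EuclideanSpace ℝ (Fin N)) :
    L v = ∑ i, L (EuclideanSpace.single i 1) * v i := by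
  conv_lhs => rw [← (EuclideanSpace.basisFun (Fin N) ℝ).sum_repr v]
  simp [mul_comm]

/-- Integration by parts `∫ Df(F) = -∫ f div F` against a compactly supported `C¹` vector field `F`;
the function `f` only has to be differentiable near the support of `F`. -/
lemma integral_hasFDerivAt_apply_eq_neg_integral_mul_div
    {F : EuclideanSpace ℝ (Fin N) → EuclideanSpace ℝ (Fin N)} (hF : ContDiff ℝ 1 F)
    (hc : HasCompactSupport F) {f : EuclideanSpace ℝ (Fin N) → ℝ}
    {f' : EuclideanSpace ℝ (Fin N) → EuclideanSpace ℝ (Fin N) →L[ℝ] ℝ}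
    (hf : ∀ x ∈ tsupport F, HasFDerivAt f (f' x) x) (hf' : ContinuousOn f' (tsupport F)) :
    ∫ x, f' x (F x)
      = -∫ x, f x * ∑ i, fderiv ℝ (fun y => F y i) x (EuclideanSpace.single i 1) := by
  have hfc : ContinuousOn f (tsupport F) := fun x hx =>
    (hf x hx).continuousAt.continuousWithinAt
  have hFi : ∀ i, ContDiff ℝ 1 (fun y => F y i) := fun i => by fun_prop
  have hts : ∀ i, tsupport (fun y => F y i) ⊆ tsupport F := fun i =>
    closure_mono fun x hx h => hx (by simp [h])
  have hF0 : ∀ i, ∀ x ∉ tsupport F, F x i = 0 := fun i x hx => by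
    simp [image_eq_zero_of_notMem_tsupport hx]
  have hF0' : ∀ i, ∀ x ∉ tsupport F, fderiv ℝ (fun y => F y i) x = 0 := fun i x hx =>
    image_eq_zero_of_notMem_tsupport fun h => hx (hts i (tsupport_fderiv_subset ℝ h))
  have I1 : ∀ i, Integrable (fun x => f' x (EuclideanSpace.single i 1) * F x i) := fun i =>
    integrable_of_continuousOn_of_isCompact hc.isCompact
      ((hf'.clm_apply continuousOn_const).mul (hFi i).continuous.continuousOn)
      fun x hx => by simp [hF0 i x hx]
  have I2 : ∀ i, Integrable (fun x => f x *
      fderiv ℝ (fun y => F y i) x (EuclideanSpace.single i 1)) := fun i =>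
    integrable_of_continuousOn_of_isCompact hc.isCompact
      (hfc.mul (((hFi i).continuous_fderiv one_ne_zero).clm_apply
        continuous_const).continuousOn) fun x hx => by simp [hF0' i x hx]
  have I3 : ∀ i, Integrable (fun x => f x * F x i) := fun i =>
    integrable_of_continuousOn_of_isCompact hc.isCompact
      (hfc.mul (hFi i).continuous.continuousOn) fun x hx => by simp [hF0 i x hx]
  have key : ∀ i, ∫ x, f' x (EuclideanSpace.single i 1) * F x i
      = -∫ x, f x * fderiv ℝ (fun y => F y i) x (EuclideanSpace.single i 1) := by
    intro i
    have := integral_bilinear_hasFDerivAt_right_eq_neg_left_of_integrable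
      (B := ContinuousLinearMap.mul ℝ ℝ) (f := f) (f' := f') (g := fun y => F y i)
      (g' := fderiv ℝ (fun y => F y i)) (v := EuclideanSpace.single i 1)
      (μ := (volume : Measure (EuclideanSpace ℝ (Fin N)))) (I1 i) (I2 i) (I3 i)
      (fun x hx => hf x (hts i hx))
      (fun x _ => ((hFi i).differentiable one_ne_zero x).hasFDerivAt)
    simp only [ContinuousLinearMap.mul_apply'] at this
    rw [this, neg_neg]
  calc ∫ x, f' x (F x) = ∫ x, ∑ i, f' x (EuclideanSpace.single i 1) * F x i := by
        congr 1; ext x; exact apply_eq_sum_coord _ _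
    _ = ∑ i, -∫ x, f x * fderiv ℝ (fun y => F y i) x (EuclideanSpace.single i 1) := by
        rw [integral_finsetSum _ fun i _ => I1 i]
        exact Finset.sum_congr rfl fun i _ => key i
    _ = _ := by
        rw [Finset.sum_neg_distrib, ← integral_finsetSum _ fun i _ => I2 i]
        simp only [Finset.mul_sum]

lemma gradient_coord (φ : EuclideanSpace ℝ (Fin N) → ℝ) (x : EuclideanSpace ℝ (Fin N))
    (i : Fin N) : gradient φ x i = fderiv ℝ φ x (EuclideanSpace.single i 1) := by
  rw [← inner_gradient_left, EuclideanSpace.inner_single_right]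
  simp

lemma contDiff_gradient {φ : EuclideanSpace ℝ (Fin N) → ℝ} (hφ : ContDiff ℝ 2 φ) :
    ContDiff ℝ 1 (gradient φ) :=
  (LinearIsometryEquiv.contDiff _).comp (hφ.fderiv_right (by norm_num))

lemma tsupport_gradient_subset (φ : EuclideanSpace ℝ (Fin N) → ℝ) :
    tsupport (gradient φ) ⊆ tsupport φ :=
  (closure_mono fun x (hx : gradient φ x ≠ 0) (h : fderiv ℝ φ x = 0) =>
    hx (by simp [gradient, h])).trans (tsupport_fderiv_subset ℝ)

lemma laplacian_eq_sum_fderiv_gradient {φ : EuclideanSpace ℝ (Fin N) → ℝ} (hφ : ContDiff ℝ 2 φ)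
    (x : EuclideanSpace ℝ (Fin N)) :
    Laplacian.laplacian φ x
      = ∑ i, fderiv ℝ (fun y => gradient φ y i) x (EuclideanSpace.single i 1) := by
  rw [InnerProductSpace.laplacian_eq_iteratedFDeriv_orthonormalBasis φ
    (EuclideanSpace.basisFun (Fin N) ℝ)]
  refine Finset.sum_congr rfl fun i _ => ?_
  have hd : DifferentiableAt ℝ (fderiv ℝ φ) x :=
    (hφ.fderiv_right (m := 1) (by norm_num)).differentiable one_ne_zero x
  simp only [gradient_coord, iteratedFDeriv_two_apply]
  rw [fderiv_clm_apply hd (by fun_prop)]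
  simp

/-- The weak formulation `∫ ⟨G, ∇θ⟩ = -∫ w θ` of `Δ v = w`, `G = ∇ v`, for a compactly supported
test function that is merely `C¹`. -/
lemma integral_fderiv_test_eq (Ω : C2Domain N) {v w : EuclideanSpace ℝ (Fin N) → ℝ}
    {G : EuclideanSpace ℝ (Fin N) → EuclideanSpace ℝ (Fin N)}
    (hw : ContinuousOn w (closure Ω.carrier)) (hG : ContinuousOn G (closure Ω.carrier))
    (hv : ∀ x ∈ Ω.carrier, HasGradientAt v (G x) x) (hl : HasWeakLaplacian Ω v w)
    {θ : EuclideanSpace ℝ (Fin N) → ℝ} (hθ : ContDiff ℝ 1 θ) (hc : HasCompactSupport θ)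
    (hsub : tsupport θ ⊆ Ω.carrier) :
    ∫ x in Ω.carrier, fderiv ℝ θ x (G x) = -∫ x in Ω.carrier, w x * θ x := by
  have hcpt : IsCompact (closure Ω.carrier) := Ω.isBounded.isCompact_closure
  have Iw : ∀ {f : EuclideanSpace ℝ (Fin N) → ℝ}, ContinuousOn f (closure Ω.carrier) →
      IntegrableOn f Ω.carrier := fun hf =>
    (hf.integrableOn_compact' hcpt hcpt.measurableSet).mono_set subset_closure
  have smooth : ∀ φ, IsTestFunction Ω φ →
      ∫ x in Ω.carrier, fderiv ℝ φ x (G x) = -∫ x in Ω.carrier, w x * φ x := by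
    intro φ hφ
    have hφ2 : ContDiff ℝ 2 φ := hφ.contDiff.of_le (WithTop.coe_le_coe.mpr le_top)
    have hts := tsupport_gradient_subset φ
    have hsub' := hts.trans hφ.tsupport_subset
    have := integral_hasFDerivAt_apply_eq_neg_integral_mul_div (contDiff_gradient hφ2)
      (hφ.hasCompactSupport.of_isClosed_subset (isClosed_tsupport _) hts)
      (f := v) (f' := fun x => InnerProductSpace.toDual ℝ _ (G x))
      (fun x hx => hv x (hsub' hx))
      ((LinearIsometryEquiv.continuous _).comp_continuousOn
        (hG.mono (hsub'.trans subset_closure)))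
    simp only [InnerProductSpace.toDual_apply_apply, ← laplacian_eq_sum_fderiv_gradient hφ2] at this
    have h0 : ∀ x ∉ Ω.carrier, x ∉ tsupport φ := fun x hx h => hx (hφ.tsupport_subset h)
    rw [← hl φ hφ, setIntegral_eq_integral_of_forall_compl_eq_zero,
      setIntegral_eq_integral_of_forall_compl_eq_zero, ← this]
    · simp [inner_gradient_right]
    · intro x hx
      rw [laplacian_eq_sum_fderiv_gradient hφ2]
      refine mul_eq_zero_of_right _ (Finset.sum_eq_zero fun i _ => ?_)
      have h1 : (fun y => gradient φ y i) =ᶠ[𝓝 x] fun _ => 0 := by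
        filter_upwards [notMem_tsupport_iff_eventuallyEq.mp fun h => h0 x hx (hts h)] with y hy
        simp [hy]
      simp [h1.fderiv_eq]
    · intro x hx
      have : fderiv ℝ φ x = 0 :=
        image_eq_zero_of_notMem_tsupport fun h => h0 x hx (tsupport_fderiv_subset ℝ h)
      simp [this]
  have I1 : ∀ {φ : EuclideanSpace ℝ (Fin N) → ℝ}, ContDiff ℝ 1 φ →
      IntegrableOn (fun x => fderiv ℝ φ x (G x)) Ω.carrier := fun hφ =>
    Iw ((hφ.continuous_fderiv one_ne_zero).continuousOn.clm_apply hG)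
  have I2 : ∀ {φ : EuclideanSpace ℝ (Fin N) → ℝ}, ContDiff ℝ 1 φ →
      IntegrableOn (fun x => w x * φ x) Ω.carrier := fun hφ =>
    Iw (hw.mul hφ.continuous.continuousOn)
  have hI := Iw (hG.norm.add hw.norm)
  set M : ℝ := ∫ x in Ω.carrier, (‖G x‖ + ‖w x‖) with hM
  rw [← sub_eq_zero, sub_neg_eq_add, ← abs_eq_zero]
  refine le_antisymm (le_of_forall_pos_le_add fun ε hε => ?_) (abs_nonneg _)
  have hM0 : 0 ≤ M := integral_nonneg fun x => by positivity
  obtain ⟨φ, h1, h2, h3, h4⟩ := exists_contDiff_approx Ω.isOpen hθ hc hsub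
    (ε := ε / (M + 1)) (by positivity)
  have hφ1 : ContDiff ℝ 1 φ := h1.of_le (by exact_mod_cast le_top)
  have hz := smooth φ ⟨h1, h2, h3⟩
  have hz' : (∫ x in Ω.carrier, fderiv ℝ φ x (G x)) + ∫ x in Ω.carrier, w x * φ x = 0 := by
    rw [hz]; ring
  rw [zero_add, ← sub_zero ((∫ x in Ω.carrier, fderiv ℝ θ x (G x)) + ∫ x in Ω.carrier, w x * θ x),
    ← hz',
    ← integral_add (I1 hθ) (I2 hθ), ← integral_add (I1 hφ1) (I2 hφ1),
    ← integral_sub (by exact (I1 hθ).add (I2 hθ)) (by exact (I1 hφ1).add (I2 hφ1)),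
    ← Real.norm_eq_abs]
  refine (norm_integral_le_of_norm_le (hI.const_mul (ε / (M + 1)))
    (Eventually.of_forall fun x => ?_)).trans ?_
  · have ha := h4 x
    have hb := ha.2 (G x)
    have h5 : |w x * φ x - w x * θ x| ≤ ε / (M + 1) * ‖w x‖ := by
      rw [← mul_sub, abs_mul, mul_comm, Real.norm_eq_abs]
      exact mul_le_mul_of_nonneg_right ha.1 (abs_nonneg _)
    rw [Real.norm_eq_abs]
    simp only [Pi.add_apply]
    rw [abs_le] at hb h5 ⊢
    constructor <;> nlinarith [hb.1, hb.2, h5.1, h5.2]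
  · rw [integral_const_mul]
    change ε / (M + 1) * M ≤ ε
    rw [div_mul_eq_mul_div, div_le_iff₀ (by positivity)]
    nlinarith

/-! ### Green's identity -/

/-- `v` is `C¹` up to the boundary with gradient `G`, has distributional Laplacian `w`, and satisfies
the Neumann condition, expressed through the local defining functions of the boundary. -/
structure IsNeumannTriple (Ω : C2Domain N) (v w : EuclideanSpace ℝ (Fin N) → ℝ)
    (G : EuclideanSpace ℝ (Fin N) → EuclideanSpace ℝ (Fin N)) : Prop where
  continuousOn_laplacian : ContinuousOn w (closure Ω.carrier)
  continuousOn_gradient : ContinuousOn G (closure Ω.carrier)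
  hasGradientAt : ∀ x ∈ Ω.carrier, HasGradientAt v (G x) x
  hasWeakLaplacian : HasWeakLaplacian Ω v w
  inner_eq_zero : ∀ x ∈ frontier Ω.carrier, ∀ U ρ, IsLocalDefiningFunction Ω.carrier x U ρ →
    inner ℝ (G x) (gradient ρ x) = 0

/-- `φ` is `C¹` in `Ω`, and `φ` and its derivative `φ'` are continuous up to the boundary. -/
structure IsC1UpToBoundary (Ω : C2Domain N) (φ : EuclideanSpace ℝ (Fin N) → ℝ)
    (φ' : EuclideanSpace ℝ (Fin N) → EuclideanSpace ℝ (Fin N) →L[ℝ] ℝ) : Prop where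
  continuousOn : ContinuousOn φ (closure Ω.carrier)
  continuousOn_deriv : ContinuousOn φ' (closure Ω.carrier)
  hasFDerivAt : ∀ x ∈ Ω.carrier, HasFDerivAt φ (φ' x) x

lemma C2Domain.isCompact_closure (Ω : C2Domain N) : IsCompact (closure Ω.carrier) :=
  Ω.isBounded.isCompact_closure

lemma C2Domain.integrableOn (Ω : C2Domain N) {f : EuclideanSpace ℝ (Fin N) → ℝ}
    (hf : ContinuousOn f (closure Ω.carrier)) : IntegrableOn f Ω.carrier :=
  (hf.integrableOn_compact' Ω.isCompact_closure Ω.isCompact_closure.measurableSet).mono_set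
    subset_closure

lemma C2Domain.integrableOn_of_continuousOn_inter (Ω : C2Domain N)
    {f : EuclideanSpace ℝ (Fin N) → ℝ} {K : Set (EuclideanSpace ℝ (Fin N))} (hK : IsClosed K)
    (hf : ContinuousOn f (closure Ω.carrier ∩ K)) (h0 : ∀ x ∉ K, f x = 0) :
    IntegrableOn f Ω.carrier := by
  have hc := Ω.isCompact_closure.inter_right hK
  refine ((hf.integrableOn_compact' hc hc.measurableSet).of_forall_sdiff_eq_zero
    isClosed_closure.measurableSet fun x hx => h0 x fun h => hx.2 ⟨hx.1, h⟩).mono_set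
    subset_closure

/-- Green's identity `∫ ⟨∇(m φ), G⟩ = -∫ w m φ` for the product of `φ` and a cut-off function `m`,
with the derivative of the product written out and all terms on one side. -/
def GreenFor (Ω : C2Domain N) (w φ : EuclideanSpace ℝ (Fin N) → ℝ)
    (G : EuclideanSpace ℝ (Fin N) → EuclideanSpace ℝ (Fin N))
    (φ' : EuclideanSpace ℝ (Fin N) → EuclideanSpace ℝ (Fin N) →L[ℝ] ℝ)
    (m : EuclideanSpace ℝ (Fin N) → ℝ) : Prop :=
  ∫ x in Ω.carrier, (m x * φ' x (G x) + φ x * fderiv ℝ m x (G x) + w x * (m x * φ x)) = 0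

lemma greenFor_of_tsupport_subset {Ω : C2Domain N} {v w φ : EuclideanSpace ℝ (Fin N) → ℝ}
    {G : EuclideanSpace ℝ (Fin N) → EuclideanSpace ℝ (Fin N)}
    {φ' : EuclideanSpace ℝ (Fin N) → EuclideanSpace ℝ (Fin N) →L[ℝ] ℝ}
    (hv : IsNeumannTriple Ω v w G) (hφ : IsC1UpToBoundary Ω φ φ')
    {m : EuclideanSpace ℝ (Fin N) → ℝ} (hm : ContDiff ℝ 1 m) (hc : HasCompactSupport m)
    (hsub : tsupport m ⊆ Ω.carrier) : GreenFor Ω w φ G φ' m := by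
  have hφd : ContDiffOn ℝ 1 φ Ω.carrier := by
    rw [show (1 : WithTop ℕ∞) = 0 + 1 from (zero_add 1).symm,
      contDiffOn_succ_iff_hasFDerivWithinAt_of_uniqueDiffOn Ω.isOpen.uniqueDiffOn]
    exact ⟨by simp, φ', contDiffOn_zero.mpr (hφ.continuousOn_deriv.mono subset_closure),
      fun x hx => (hφ.hasFDerivAt x hx).hasFDerivWithinAt⟩
  have hts : tsupport (fun x => m x * φ x) ⊆ tsupport m := tsupport_mul_subset_left
  have hθ : ContDiff ℝ 1 (fun x => m x * φ x) := contDiff_of_contDiffAt_tsupport fun x hx =>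
    hm.contDiffAt.mul (hφd.contDiffAt (Ω.isOpen.mem_nhds (hsub (hts hx))))
  have := integral_fderiv_test_eq Ω hv.continuousOn_laplacian hv.continuousOn_gradient
    hv.hasGradientAt hv.hasWeakLaplacian hθ hc.mul_right (hts.trans hsub)
  have hG := hv.continuousOn_gradient
  have hm' := hm.continuous_fderiv one_ne_zero
  have e : ∀ x ∈ Ω.carrier, fderiv ℝ (fun x => m x * φ x) x (G x)
      = m x * φ' x (G x) + φ x * fderiv ℝ m x (G x) := by
    intro x hx
    have hd : HasFDerivAt (fun x => m x * φ x) _ x :=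
      (hm.differentiable one_ne_zero x).hasFDerivAt.mul (hφ.hasFDerivAt x hx)
    rw [hd.fderiv]
    simp
  rw [GreenFor, integral_add, ← setIntegral_congr_fun Ω.isOpen.measurableSet e, this,
    neg_add_cancel]
  · exact Ω.integrableOn ((hm.continuous.continuousOn.mul (hφ.continuousOn_deriv.clm_apply hG)).add
      (hφ.continuousOn.mul (hm'.continuousOn.clm_apply hG)))
  · exact Ω.integrableOn (hv.continuousOn_laplacian.mul
      (hm.continuous.continuousOn.mul hφ.continuousOn))

lemma contDiffAt_gradient {ρ : EuclideanSpace ℝ (Fin N) → ℝ} {x : EuclideanSpace ℝ (Fin N)}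
    (hρ : ContDiffAt ℝ 2 ρ x) : ContDiffAt ℝ 1 (gradient ρ) x :=
  (LinearIsometryEquiv.contDiff _).contDiffAt.comp x (hρ.fderiv_right (by norm_num))

/-- The integrals `∫ ψ χ'(-ρ) |∇ρ|²` are bounded uniformly in the transition function `χ`. For a
monotone `χ` that passes from `0` to `1` between `ε` and `2ε` this replaces the estimate `O(ε)` of the volume of
the strip `{ε < -ρ < 2ε}`. It holds because `∇(χ(-ρ))` may be integrated by parts against the
`C¹` field `ψ ∇ρ`. -/
lemma exists_integral_deriv_transition_le {U : Set (EuclideanSpace ℝ (Fin N))} (hU : IsOpen U)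
    {ρ ψ : EuclideanSpace ℝ (Fin N) → ℝ} (hρ : ContDiffOn ℝ 2 ρ U) (hψ : ContDiff ℝ 1 ψ)
    (hc : HasCompactSupport ψ) (hsub : tsupport ψ ⊆ U) :
    ∃ C, 0 ≤ C ∧ ∀ χ : ℝ → ℝ, ContDiff ℝ 1 χ → (∀ s, |χ s| ≤ 1) →
      Integrable (fun x => ψ x * deriv χ (-ρ x) * ‖gradient ρ x‖ ^ 2) ∧
      ∫ x, ψ x * deriv χ (-ρ x) * ‖gradient ρ x‖ ^ 2 ≤ C := by
  have hρx : ∀ x ∈ tsupport ψ, ContDiffAt ℝ 2 ρ x := fun x hx =>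
    hρ.contDiffAt (hU.mem_nhds (hsub hx))
  let F : EuclideanSpace ℝ (Fin N) → EuclideanSpace ℝ (Fin N) := fun x => ψ x • gradient ρ x
  have hts : tsupport F ⊆ tsupport ψ := tsupport_smul_subset_left _ _
  have hF : ContDiff ℝ 1 F := contDiff_of_contDiffAt_tsupport fun x hx =>
    hψ.contDiffAt.smul (contDiffAt_gradient (hρx x (hts hx)))
  have hFc : HasCompactSupport F := hc.smul_right
  have hρc : ContinuousOn ρ (tsupport ψ) := hρ.continuousOn.mono hsub
  have hρ'c : ContinuousOn (fderiv ℝ ρ) (tsupport ψ) :=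
    (hρ.continuousOn_fderiv_of_isOpen hU (by norm_num)).mono hsub
  have hgc : ContinuousOn (gradient ρ) (tsupport ψ) :=
    (LinearIsometryEquiv.continuous _).comp_continuousOn hρ'c
  let d : EuclideanSpace ℝ (Fin N) → ℝ := fun x =>
    ∑ i, fderiv ℝ (fun y => F y i) x (EuclideanSpace.single i 1)
  have hdi : Integrable d := by
    refine integrable_finsetSum _ fun i _ => ?_
    have hFi : ContDiff ℝ 1 (fun y => F y i) := by fun_prop
    refine integrable_of_continuousOn_of_isCompact hFc.isCompact
      ((hFi.continuous_fderiv one_ne_zero).clm_apply continuous_const).continuousOn fun x hx => ?_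
    have h1 : (fun y => F y i) =ᶠ[𝓝 x] fun _ => 0 := by
      filter_upwards [notMem_tsupport_iff_eventuallyEq.mp hx] with y hy
      simp [hy]
    simp [h1.fderiv_eq]
  refine ⟨∫ x, |d x|, integral_nonneg fun x => abs_nonneg _, fun χ hχ hχ1 => ⟨?_, ?_⟩⟩
  · refine integrable_of_continuousOn_of_isCompact hc.isCompact ?_ fun x hx => by
      simp [image_eq_zero_of_notMem_tsupport hx]
    exact (hψ.continuous.continuousOn.mul
      ((hχ.continuous_deriv le_rfl).comp_continuousOn hρc.neg)).mul (hgc.norm.pow 2)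
  have := integral_hasFDerivAt_apply_eq_neg_integral_mul_div hF hFc (f := fun x => χ (-ρ x))
    (f' := fun x => deriv χ (-ρ x) • -fderiv ℝ ρ x)
    (fun x hx => (hχ.differentiable one_ne_zero _).hasDerivAt.comp_hasFDerivAt x
      ((hρx x (hts hx)).differentiableAt (by norm_num)).hasFDerivAt.neg)
    ((((hχ.continuous_deriv le_rfl).comp_continuousOn hρc.neg).smul hρ'c.neg).mono hts)
  have e : ∀ x, (deriv χ (-ρ x) • -fderiv ℝ ρ x) (F x)
      = -(ψ x * deriv χ (-ρ x) * ‖gradient ρ x‖ ^ 2) := by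
    intro x
    have : fderiv ℝ ρ x (gradient ρ x) = ‖gradient ρ x‖ ^ 2 := by
      rw [← inner_gradient_left, real_inner_self_eq_norm_sq]
    simp only [F, smul_apply, neg_apply, map_smul,
      smul_eq_mul, this]
    ring
  simp only [e, integral_neg, neg_inj] at this
  rw [this]
  refine (le_abs_self _).trans ((abs_integral_le_integral_abs).trans ?_)
  refine integral_mono_of_nonneg (Eventually.of_forall fun x => abs_nonneg _) hdi.abs
    (Eventually.of_forall fun x => ?_)
  change |χ (-ρ x) * d x| ≤ |d x|
  rw [abs_mul]
  exact mul_le_of_le_one_left (abs_nonneg _) (hχ1 _)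

/-- For `ε > 0`, a smooth non-decreasing function that is `0` on `(-∞, ε]` and `1` on `[2ε, ∞)`. -/
noncomputable def transition (ε s : ℝ) : ℝ := Real.smoothTransition (s / ε - 1)

lemma contDiff_transition (ε : ℝ) : ContDiff ℝ 1 (transition ε) :=
  (Real.smoothTransition.contDiff (n := 1)).comp ((contDiff_id.div_const ε).sub contDiff_const)

lemma abs_transition_le (ε s : ℝ) : |transition ε s| ≤ 1 := by
  rw [transition, abs_of_nonneg (Real.smoothTransition.nonneg _)]
  exact Real.smoothTransition.le_one _

lemma transition_eq_zero {ε s : ℝ} (hε : 0 < ε) (h : s ≤ ε) : transition ε s = 0 :=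
  Real.smoothTransition.zero_of_nonpos (by rw [sub_nonpos, div_le_one hε]; exact h)

lemma transition_eq_one {ε s : ℝ} (hε : 0 < ε) (h : 2 * ε ≤ s) : transition ε s = 1 :=
  Real.smoothTransition.one_of_one_le (by
    rw [le_sub_iff_add_le, le_div_iff₀ hε]; linarith)

lemma deriv_transition_nonneg {ε : ℝ} (hε : 0 < ε) (s : ℝ) : 0 ≤ deriv (transition ε) s := by
  refine Monotone.deriv_nonneg (fun a b h => Real.smoothTransition.monotone ?_)
  gcongr

lemma deriv_transition_eq_zero {ε s : ℝ} (hε : 0 < ε) (h : 2 * ε < s) :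
    deriv (transition ε) s = 0 := by
  have : transition ε =ᶠ[𝓝 s] fun _ => 1 := by
    filter_upwards [lt_mem_nhds h] with y hy using transition_eq_one hε hy.le
  simp [this.deriv_eq]

lemma IsLocalDefiningFunction.of_mem {Ω U : Set (EuclideanSpace ℝ (Fin N))}
    {x : EuclideanSpace ℝ (Fin N)} {ρ : EuclideanSpace ℝ (Fin N) → ℝ}
    (h : IsLocalDefiningFunction Ω x U ρ) {y : EuclideanSpace ℝ (Fin N)} (hy : y ∈ U) :
    IsLocalDefiningFunction Ω y U ρ :=
  ⟨h.isOpen, hy, h.contDiffOn, h.gradient_ne_zero, h.mem_iff⟩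

/-- Near the boundary the normal component of `G` is small, uniformly on compact sets. -/
lemma exists_abs_mul_fderiv_le {Ω : C2Domain N} {v w φ : EuclideanSpace ℝ (Fin N) → ℝ}
    {G : EuclideanSpace ℝ (Fin N) → EuclideanSpace ℝ (Fin N)}
    (hv : IsNeumannTriple Ω v w G) (hφ : ContinuousOn φ (closure Ω.carrier))
    {x₀ : EuclideanSpace ℝ (Fin N)} {U K : Set (EuclideanSpace ℝ (Fin N))}
    {ρ : EuclideanSpace ℝ (Fin N) → ℝ} (hρ : IsLocalDefiningFunction Ω.carrier x₀ U ρ)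
    (hK : IsCompact K) (hKU : K ⊆ U) {δ : ℝ} (hδ : 0 < δ) :
    ∃ c, 0 < c ∧ ∀ x ∈ Ω.carrier ∩ K, -ρ x < c →
      |φ x * fderiv ℝ ρ x (G x)| ≤ δ * ‖gradient ρ x‖ ^ 2 := by
  have hC : IsCompact (closure Ω.carrier ∩ K) := Ω.isCompact_closure.inter_right hK.isClosed
  have hρ'c : ContinuousOn (fderiv ℝ ρ) U :=
    hρ.contDiffOn.continuousOn_fderiv_of_isOpen hρ.isOpen (by norm_num)
  have hgc : ContinuousOn (gradient ρ) U :=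
    (LinearIsometryEquiv.continuous _).comp_continuousOn hρ'c
  have hs1 : closure Ω.carrier ∩ K ⊆ closure Ω.carrier := inter_subset_left
  have hs2 : closure Ω.carrier ∩ K ⊆ U := inter_subset_right.trans hKU
  -- On the compact set where the estimate fails, `ρ` is negative, hence bounded away from zero.
  let h : EuclideanSpace ℝ (Fin N) → ℝ := fun x =>
    |φ x * fderiv ℝ ρ x (G x)| - δ * ‖gradient ρ x‖ ^ 2
  have hh : ContinuousOn h (closure Ω.carrier ∩ K) :=
    ((hφ.mono hs1).mul ((hρ'c.mono hs2).clm_apply (hv.continuousOn_gradient.mono hs1))).abs.sub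
      (continuousOn_const.mul ((hgc.mono hs2).norm.pow 2))
  have hZ : IsCompact ((closure Ω.carrier ∩ K) ∩ h ⁻¹' Ici 0) :=
    hC.of_isClosed_subset (hh.preimage_isClosed_of_isClosed hC.isClosed isClosed_Ici)
      inter_subset_left
  have hneg : ∀ x ∈ (closure Ω.carrier ∩ K) ∩ h ⁻¹' Ici 0, 0 < -ρ x := by
    rintro x ⟨⟨hx1, hx2⟩, hx3⟩
    by_cases hx : x ∈ Ω.carrier
    · linarith [(hρ.mem_iff x (hKU hx2)).mp hx]
    · exfalso
      have hfr : x ∈ frontier Ω.carrier := by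
        rw [frontier, Ω.isOpen.interior_eq]; exact ⟨hx1, hx⟩
      have h0 := hv.inner_eq_zero x hfr U ρ (hρ.of_mem (hKU hx2))
      rw [real_inner_comm, inner_gradient_left] at h0
      have hp : 0 < ‖gradient ρ x‖ := norm_pos_iff.mpr (hρ.gradient_ne_zero x (hKU hx2))
      have : 0 ≤ h x := hx3
      simp only [h, h0, mul_zero, abs_zero] at this
      have : 0 < δ * ‖gradient ρ x‖ ^ 2 := by positivity
      linarith
  obtain ⟨c, hc, hc'⟩ := hZ.exists_forall_le' (hρ.contDiffOn.continuousOn.neg.mono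
    (inter_subset_left.trans hs2)) hneg
  refine ⟨c, hc, fun x hx hxc => ?_⟩
  by_contra hcon
  have := hc' x ⟨⟨subset_closure hx.1, hx.2⟩, by simp only [h, mem_preimage, mem_Ici]; linarith⟩
  rw [Pi.neg_apply] at this
  linarith

/-- Green's identity localized near a boundary point. The cut-off `ψ χ(-ρ/ε)` is admissible in the
weak formulation, and as `ε → 0` the term containing `∇(χ(-ρ/ε))` vanishes, because the normal
component of `G` tends to zero at the boundary while `∇(χ(-ρ/ε))` stays bounded in `L¹`. -/
lemma greenFor_boundary {Ω : C2Domain N} {v w φ : EuclideanSpace ℝ (Fin N) → ℝ}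
    {G : EuclideanSpace ℝ (Fin N) → EuclideanSpace ℝ (Fin N)}
    {φ' : EuclideanSpace ℝ (Fin N) → EuclideanSpace ℝ (Fin N) →L[ℝ] ℝ}
    (hv : IsNeumannTriple Ω v w G) (hφ : IsC1UpToBoundary Ω φ φ')
    {x₀ : EuclideanSpace ℝ (Fin N)} {U : Set (EuclideanSpace ℝ (Fin N))}
    {ρ ψ : EuclideanSpace ℝ (Fin N) → ℝ} (hρ : IsLocalDefiningFunction Ω.carrier x₀ U ρ)
    (hψ : ContDiff ℝ 1 ψ) (hc : HasCompactSupport ψ) (hψ0 : ∀ x, 0 ≤ ψ x)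
    (hsub : tsupport ψ ⊆ U) : GreenFor Ω w φ G φ' ψ := by
  obtain ⟨C, hC, hbound⟩ :=
    exists_integral_deriv_transition_le hρ.isOpen hρ.contDiffOn hψ hc hsub
  have hG := hv.continuousOn_gradient
  have hψ' := hψ.continuous_fderiv one_ne_zero
  have hρx : ∀ x ∈ tsupport ψ, ContDiffAt ℝ 2 ρ x := fun x hx =>
    hρ.contDiffOn.contDiffAt (hρ.isOpen.mem_nhds (hsub hx))
  have hρc : ContinuousOn ρ (tsupport ψ) := hρ.contDiffOn.continuousOn.mono hsub
  have hψz : ∀ x ∉ tsupport ψ, ψ x = 0 := fun x hx => image_eq_zero_of_notMem_tsupport hx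
  have hψz' : ∀ x ∉ tsupport ψ, fderiv ℝ ψ x = 0 := fun x hx =>
    image_eq_zero_of_notMem_tsupport fun h => hx (tsupport_fderiv_subset ℝ h)
  let A : EuclideanSpace ℝ (Fin N) → ℝ := fun x =>
    ψ x * φ' x (G x) + φ x * fderiv ℝ ψ x (G x) + w x * (ψ x * φ x)
  have hAc : ContinuousOn A (closure Ω.carrier) :=
    ((hψ.continuous.continuousOn.mul (hφ.continuousOn_deriv.clm_apply hG)).add
      (hφ.continuousOn.mul (hψ'.continuousOn.clm_apply hG))).add
      (hv.continuousOn_laplacian.mul (hψ.continuous.continuousOn.mul hφ.continuousOn))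
  have hA : IntegrableOn A Ω.carrier := Ω.integrableOn hAc
  have hA0 : ∀ x ∉ tsupport ψ, A x = 0 := fun x hx => by simp [A, hψz x hx, hψz' x hx]
  have hηA : ∀ ε, IntegrableOn (fun x => transition ε (-ρ x) * A x) Ω.carrier := fun ε =>
    Ω.integrableOn_of_continuousOn_inter (isClosed_tsupport ψ)
      ((((contDiff_transition ε).continuous.comp_continuousOn hρc.neg).mono
        inter_subset_right).mul (hAc.mono inter_subset_left))
      fun x hx => by simp [hA0 x hx]
  -- The weak formulation with the test function `ψ χ(-ρ/ε) φ`.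
  have key : ∀ ε, 0 < ε → ∫ x in Ω.carrier, transition ε (-ρ x) * A x
      = ∫ x in Ω.carrier, ψ x * deriv (transition ε) (-ρ x) * (φ x * fderiv ℝ ρ x (G x)) := by
    intro ε hε
    let m : EuclideanSpace ℝ (Fin N) → ℝ := fun x => ψ x * transition ε (-ρ x)
    have hts : tsupport m ⊆ tsupport ψ := tsupport_mul_subset_left
    have hm : ContDiff ℝ 1 m := contDiff_of_contDiffAt_tsupport fun x hx =>
      hψ.contDiffAt.mul ((contDiff_transition ε).contDiffAt.comp x
        ((hρx x (hts hx)).of_le (by norm_num)).neg)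
    have hmΩ : tsupport m ⊆ Ω.carrier := by
      have hcl : IsClosed (tsupport ψ ∩ ρ ⁻¹' Iic (-ε)) :=
        hρc.preimage_isClosed_of_isClosed (isClosed_tsupport ψ) isClosed_Iic
      refine (closure_minimal (fun x hx => ?_) hcl).trans fun x hx =>
        (hρ.mem_iff x (hsub hx.1)).mpr (lt_of_le_of_lt hx.2 (by linarith))
      refine ⟨hts (subset_tsupport _ hx), ?_⟩
      by_contra hcon
      have : -ρ x ≤ ε := by
        simp only [mem_preimage, mem_Iic, not_le] at hcon
        linarith
      exact hx (by simp [m, transition_eq_zero hε this])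
    have hgreen := greenFor_of_tsupport_subset hv hφ hm hc.mul_right hmΩ
    rw [GreenFor] at hgreen
    rw [← sub_eq_zero, ← hgreen, ← integral_sub (hηA ε)]
    · congr 1
      ext x
      by_cases hx : x ∈ tsupport ψ
      · have hd : HasFDerivAt m _ x := (hψ.differentiable one_ne_zero x).hasFDerivAt.mul
          (((contDiff_transition ε).differentiable one_ne_zero _).hasDerivAt.comp_hasFDerivAt x
            ((hρx x hx).differentiableAt (by norm_num)).hasFDerivAt.neg)
        rw [hd.fderiv]
        simp only [A, m, add_apply,
          smul_apply, neg_apply, smul_eq_mul]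
        ring
      · have h1 : m x = 0 := by simp [m, hψz x hx]
        have h2 : fderiv ℝ m x = 0 :=
          image_eq_zero_of_notMem_tsupport fun h => hx (hts (tsupport_fderiv_subset ℝ h))
        simp [h1, h2, hA0 x hx, hψz x hx]
    · refine Ω.integrableOn_of_continuousOn_inter (isClosed_tsupport ψ) ?_
        fun x hx => by simp [hψz x hx]
      have hρ'c : ContinuousOn (fderiv ℝ ρ) (tsupport ψ) :=
        (hρ.contDiffOn.continuousOn_fderiv_of_isOpen hρ.isOpen (by norm_num)).mono hsub
      exact (hψ.continuous.continuousOn.mul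
        ((((contDiff_transition ε).continuous_deriv le_rfl).comp_continuousOn hρc.neg).mono
          inter_subset_right)).mul ((hφ.continuousOn.mono inter_subset_left).mul
          ((hρ'c.mono inter_subset_right).clm_apply (hG.mono inter_subset_left)))
  have hεn : Tendsto (fun n : ℕ => 1 / ((n : ℝ) + 1)) atTop (𝓝 0) :=
    tendsto_one_div_add_atTop_nhds_zero_nat
  have hlim : Tendsto (fun n : ℕ => ∫ x in Ω.carrier, transition (1 / ((n : ℝ) + 1)) (-ρ x) * A x)
      atTop (𝓝 (∫ x in Ω.carrier, A x)) := by
    refine tendsto_integral_of_dominated_convergence (fun x => |A x|)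
      (fun n => (hηA _).aestronglyMeasurable) hA.abs (fun n => Eventually.of_forall fun x => ?_) ?_
    · rw [Real.norm_eq_abs, abs_mul]
      exact mul_le_of_le_one_left (abs_nonneg _) (abs_transition_le _ _)
    · refine (ae_restrict_iff' Ω.isOpen.measurableSet).mpr (Eventually.of_forall fun x hx => ?_)
      by_cases hxs : x ∈ tsupport ψ
      · have hneg := (hρ.mem_iff x (hsub hxs)).mp hx
        refine tendsto_const_nhds.congr' ?_
        filter_upwards [hεn.eventually (gt_mem_nhds (show 0 < -ρ x / 2 by linarith))] with n hn
        rw [transition_eq_one (by positivity) (by linarith), one_mul]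
      · simp [hA0 x hxs]
  change ∫ x in Ω.carrier, A x = 0
  rw [← abs_eq_zero]
  refine le_antisymm (le_of_forall_pos_le_add fun δ hδ => ?_) (abs_nonneg _)
  obtain ⟨c, hc0, hc1⟩ := exists_abs_mul_fderiv_le hv hφ.continuousOn hρ hc.isCompact hsub
    (δ := δ / (C + 1)) (by positivity)
  refine le_of_tendsto hlim.abs ?_
  filter_upwards [hεn.eventually (gt_mem_nhds (half_pos hc0))] with n hn
  set ε : ℝ := 1 / ((n : ℝ) + 1) with hε
  have hεpos : 0 < ε := by positivity
  obtain ⟨hint, hle⟩ := hbound _ (contDiff_transition ε) (abs_transition_le ε)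
  have hnn : ∀ x, 0 ≤ ψ x * deriv (transition ε) (-ρ x) * ‖gradient ρ x‖ ^ 2 := fun x =>
    mul_nonneg (mul_nonneg (hψ0 x) (deriv_transition_nonneg hεpos _)) (sq_nonneg _)
  rw [key ε hεpos, ← Real.norm_eq_abs]
  calc _ ≤ ∫ x in Ω.carrier, δ / (C + 1) *
        (ψ x * deriv (transition ε) (-ρ x) * ‖gradient ρ x‖ ^ 2) := by
        refine norm_integral_le_of_norm_le (hint.integrableOn.const_mul _)
          ((ae_restrict_iff' Ω.isOpen.measurableSet).mpr (Eventually.of_forall fun x hx => ?_))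
        by_cases hxs : x ∈ tsupport ψ
        · by_cases h2 : 2 * ε < -ρ x
          · simp [deriv_transition_eq_zero hεpos h2]
          · have := hc1 x ⟨hx, hxs⟩ (by linarith)
            rw [norm_mul, Real.norm_eq_abs,
              abs_of_nonneg (mul_nonneg (hψ0 x) (deriv_transition_nonneg hεpos _)),
              Real.norm_eq_abs]
            calc _ ≤ ψ x * deriv (transition ε) (-ρ x) * (δ / (C + 1) * ‖gradient ρ x‖ ^ 2) :=
                  mul_le_mul_of_nonneg_left this
                    (mul_nonneg (hψ0 x) (deriv_transition_nonneg hεpos _))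
              _ = _ := by ring
        · simp [hψz x hxs]
    _ = δ / (C + 1) * ∫ x in Ω.carrier,
        (ψ x * deriv (transition ε) (-ρ x) * ‖gradient ρ x‖ ^ 2) := integral_const_mul _ _
    _ ≤ δ / (C + 1) * C := by
        refine mul_le_mul_of_nonneg_left (le_trans ?_ hle) (by positivity)
        exact setIntegral_le_integral hint (Eventually.of_forall hnn)
    _ ≤ 0 + δ := by
        rw [div_mul_eq_mul_div, zero_add, div_le_iff₀ (by positivity)]
        nlinarith

open scoped Manifold in
/-- Green's identity `∫ ⟨∇φ, ∇v⟩ = -∫ φ Δv` for `v` in the domain of the Neumann Laplacian. -/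
theorem green_identity {Ω : C2Domain N} {v w φ : EuclideanSpace ℝ (Fin N) → ℝ}
    {G : EuclideanSpace ℝ (Fin N) → EuclideanSpace ℝ (Fin N)}
    {φ' : EuclideanSpace ℝ (Fin N) → EuclideanSpace ℝ (Fin N) →L[ℝ] ℝ}
    (hv : IsNeumannTriple Ω v w G) (hφ : IsC1UpToBoundary Ω φ φ') :
    ∫ x in Ω.carrier, φ' x (G x) = -∫ x in Ω.carrier, w x * φ x := by
  have hG := hv.continuousOn_gradient
  have hcover : ∀ x ∈ closure Ω.carrier, ∃ V : Set (EuclideanSpace ℝ (Fin N)), IsOpen V ∧ x ∈ V ∧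
      ∀ ψ : EuclideanSpace ℝ (Fin N) → ℝ, ContDiff ℝ 1 ψ → HasCompactSupport ψ →
        (∀ x, 0 ≤ ψ x) → tsupport ψ ⊆ V → GreenFor Ω w φ G φ' ψ := by
    intro x hx
    by_cases hxΩ : x ∈ Ω.carrier
    · exact ⟨Ω.carrier, Ω.isOpen, hxΩ, fun ψ h1 h2 _ h4 =>
        greenFor_of_tsupport_subset hv hφ h1 h2 h4⟩
    · obtain ⟨U, ρ, hρ⟩ := Ω.c2_boundary x (by
        rw [frontier, Ω.isOpen.interior_eq]; exact ⟨hx, hxΩ⟩)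
      exact ⟨U, hρ.isOpen, hρ.mem, fun ψ h1 h2 h3 h4 => greenFor_boundary hv hφ hρ h1 h2 h3 h4⟩
  choose! V hVo hVm hV using hcover
  -- Intersecting with unit balls makes the supports of the partition of unity compact.
  obtain ⟨t, ht⟩ := Ω.isCompact_closure.elim_finite_subcover_image
    (b := closure Ω.carrier) (c := fun x => V x ∩ Metric.ball x 1)
    (fun x hx => (hVo x hx).inter Metric.isOpen_ball)
    fun x hx => mem_biUnion hx ⟨hVm x hx, Metric.mem_ball_self one_pos⟩
  obtain ⟨hts, htf, htc⟩ := ht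
  have := htf.fintype
  obtain ⟨f, hf⟩ := SmoothPartitionOfUnity.exists_isSubordinate
    𝓘(ℝ, EuclideanSpace ℝ (Fin N)) isClosed_closure
    (fun x : t => V x ∩ Metric.ball (x : EuclideanSpace ℝ (Fin N)) 1)
    (fun x => (hVo x (hts x.2)).inter Metric.isOpen_ball)
    (by rw [← biUnion_eq_iUnion t fun x _ => V x ∩ Metric.ball x 1]; exact htc)
  have hfd : ∀ i, ContDiff ℝ 1 (f i) := fun i =>
    (f i).contMDiff.contDiff.of_le (WithTop.coe_le_coe.mpr le_top)
  have hloc : ∀ i, GreenFor Ω w φ G φ' (f i) := by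
    intro i
    refine hV i (hts i.2) _ (hfd i) ?_ (fun x => f.nonneg i x) ((hf i).trans inter_subset_left)
    exact Metric.isCompact_of_isClosed_isBounded (isClosed_tsupport _)
      (Metric.isBounded_ball.subset ((hf i).trans inter_subset_right))
  have hsum : ∀ x ∈ closure Ω.carrier, ∑ i, f i x = 1 := fun x hx => by
    rw [← finsum_eq_sum_of_fintype]; exact f.sum_eq_one hx
  have hsum' : ∀ x ∈ Ω.carrier, ∀ y, ∑ i, fderiv ℝ (f i) x y = 0 := by
    intro x hx y
    have h1 : HasFDerivAt (fun z => ∑ i, f i z) (∑ i, fderiv ℝ (f i) x) x :=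
      HasFDerivAt.fun_sum fun i _ => ((hfd i).differentiable one_ne_zero x).hasFDerivAt
    have h2 : (fun z => ∑ i, f i z) =ᶠ[𝓝 x] fun _ => (1 : ℝ) := by
      filter_upwards [Ω.isOpen.mem_nhds hx] with z hz using hsum z (subset_closure hz)
    have h3 := h1.unique ((hasFDerivAt_const (1 : ℝ) x).congr_of_eventuallyEq h2)
    have := congrArg (fun L : EuclideanSpace ℝ (Fin N) →L[ℝ] ℝ => L y) h3
    simpa [sum_apply] using this
  have hint : ∀ i, IntegrableOn (fun x => f i x * φ' x (G x) + φ x * fderiv ℝ (f i) x (G x)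
      + w x * (f i x * φ x)) Ω.carrier := fun i =>
    Ω.integrableOn ((((hfd i).continuous.continuousOn.mul (hφ.continuousOn_deriv.clm_apply hG)).add
      (hφ.continuousOn.mul (((hfd i).continuous_fderiv one_ne_zero).continuousOn.clm_apply hG))).add
      (hv.continuousOn_laplacian.mul ((hfd i).continuous.continuousOn.mul hφ.continuousOn)))
  have htotal : ∫ x in Ω.carrier, (φ' x (G x) + w x * φ x) = 0 := by
    rw [← Finset.sum_eq_zero fun i (_ : i ∈ Finset.univ) => hloc i]
    rw [← integral_finsetSum _ fun i _ => hint i]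
    refine setIntegral_congr_fun Ω.isOpen.measurableSet fun x hx => ?_
    simp only [Finset.sum_add_distrib, ← Finset.sum_mul, ← Finset.mul_sum,
      hsum x (subset_closure hx), hsum' x hx]
    ring
  rw [integral_add (Ω.integrableOn (hφ.continuousOn_deriv.clm_apply hG))
    (by exact Ω.integrableOn (hv.continuousOn_laplacian.mul hφ.continuousOn))] at htotal
  linarith

/-! ### Differentiating integrals along curves in `C(closure Ω)` -/

lemma ext_apply {Ω : C2Domain N} (v : CBar Ω) {x : EuclideanSpace ℝ (Fin N)}
    (hx : x ∈ closure Ω.carrier) : ext v x = v ⟨x, hx⟩ :=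
  Subtype.val_injective.extend_apply v 0 ⟨x, hx⟩

lemma continuousOn_ext {Ω : C2Domain N} (v : CBar Ω) :
    ContinuousOn (ext v) (closure Ω.carrier) := by
  rw [continuousOn_iff_continuous_domRestrict]
  convert v.continuous using 1
  funext x
  exact ext_apply v x.2

lemma integrableOn_ext {Ω : C2Domain N} (v : CBar Ω) : IntegrableOn (ext v) Ω.carrier :=
  Ω.integrableOn (continuousOn_ext v)

lemma C2Domain.volume_lt_top (Ω : C2Domain N) : volume Ω.carrier < ⊤ :=
  Ω.isBounded.measure_lt_top

lemma C2Domain.volume_real_pos (Ω : C2Domain N) : 0 < volume.real Ω.carrier :=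
  ENNReal.toReal_pos (Ω.isOpen.measure_pos volume Ω.isConnected.nonempty).ne' Ω.volume_lt_top.ne

/-- Integration over `Ω`, as a continuous linear functional on `C(closure Ω)`. -/
noncomputable def integralCLM (Ω : C2Domain N) : CBar Ω →L[ℝ] ℝ :=
  LinearMap.mkContinuous
    { toFun := fun v => ∫ x in Ω.carrier, ext v x
      map_add' := fun v w => by
        rw [← integral_add (integrableOn_ext v) (integrableOn_ext w)]
        refine setIntegral_congr_fun Ω.isOpen.measurableSet fun x hx => ?_
        simp [ext_apply _ (subset_closure hx)]
      map_smul' := fun c v => by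
        rw [RingHom.id_apply, ← integral_smul]
        refine setIntegral_congr_fun Ω.isOpen.measurableSet fun x hx => ?_
        simp [ext_apply _ (subset_closure hx)] }
    (volume.real Ω.carrier) fun v => by
      rw [mul_comm]
      refine norm_setIntegral_le_of_norm_le_const Ω.volume_lt_top fun x hx => ?_
      rw [ext_apply v (subset_closure hx)]
      exact v.norm_coe_le_norm _

lemma integralCLM_apply {Ω : C2Domain N} (v : CBar Ω) :
    integralCLM Ω v = ∫ x in Ω.carrier, ext v x := rfl

lemma integralCLM_eq_of_eqOn {Ω : C2Domain N} (v : CBar Ω) {f : EuclideanSpace ℝ (Fin N) → ℝ}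
    (h : ∀ x (hx : x ∈ Ω.carrier), v ⟨x, subset_closure hx⟩ = f x) :
    integralCLM Ω v = ∫ x in Ω.carrier, f x :=
  setIntegral_congr_fun Ω.isOpen.measurableSet fun x hx => by
    rw [ext_apply v (subset_closure hx), h x hx]

lemma integralCLM_nonneg {Ω : C2Domain N} (v : CBar Ω) (hv : 0 ≤ v) : 0 ≤ integralCLM Ω v :=
  setIntegral_nonneg Ω.isOpen.measurableSet fun x hx => by
    rw [ext_apply v (subset_closure hx)]; exact hv _

/-- The function `|v|^p`, for `p ≥ 0`. -/
noncomputable def absPow {Ω : C2Domain N} (p : ℝ) (hp : 0 ≤ p) (v : CBar Ω) : CBar Ω :=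
  ⟨fun x => |v x| ^ p, v.continuous.abs.rpow_const fun _ => Or.inr hp⟩

lemma hasDerivAt_mul_abs_rpow {p : ℝ} (hp : 1 < p) (s : ℝ) :
    HasDerivAt (fun s : ℝ => s * |s| ^ p) ((p + 1) * |s| ^ p) s := by
  refine ((hasDerivAt_id s).mul (hasDerivAt_abs_rpow s hp)).congr_deriv ?_
  rcases eq_or_ne s 0 with rfl | hs
  · simp [Real.zero_rpow (by linarith : p ≠ 0)]
  · have h : |s| ^ p = |s| ^ (p - 2) * s ^ 2 := by
      rw [← sq_abs s, ← Real.rpow_natCast, ← Real.rpow_add (abs_pos.mpr hs)]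
      norm_num
    simp only [id]
    rw [h]
    ring

lemma IsNeumannLaplacian.exists_isNeumannTriple {Ω : C2Domain N} {v w : CBar Ω}
    (h : IsNeumannLaplacian Ω v w) : ∃ G, IsNeumannTriple Ω (ext v) (ext w) G := by
  obtain ⟨q, -, -, hl, G, hG, hg, hn⟩ := h
  refine ⟨G, continuousOn_ext w, hG, hg, hl, fun x hx U ρ hρ => ?_⟩
  have := hn x hx _ ⟨U, ρ, hρ, rfl⟩
  rw [inner_smul_right] at this
  exact (mul_eq_zero.mp this).resolve_left
    (inv_ne_zero (norm_ne_zero_iff.mpr (hρ.gradient_ne_zero x hρ.mem)))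

lemma integralCLM_laplacian_eq_zero {Ω : C2Domain N} {v w : CBar Ω}
    (h : IsNeumannLaplacian Ω v w) : integralCLM Ω w = 0 := by
  obtain ⟨G, hG⟩ := h.exists_isNeumannTriple
  have := green_identity hG (φ := fun _ => 1) (φ' := fun _ => 0)
    ⟨continuousOn_const, continuousOn_const, fun x _ => hasFDerivAt_const 1 x⟩
  simp only [zero_apply, integral_zero, mul_one] at this
  rw [integralCLM_apply]
  linarith

/-- The squared `L²` norm of the gradient. -/
noncomputable def dirichlet (Ω : C2Domain N) (v : CBar Ω) : ℝ :=
  ∫ x in Ω.carrier, ‖gradient (ext v) x‖ ^ 2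

/-- As `|∇a|² - |∇b|² = ⟨∇(a - b), ∇a + ∇b⟩`, Green's identity expresses the difference of two
Dirichlet integrals without gradients. -/
lemma dirichlet_sub_dirichlet {Ω : C2Domain N} {a b wa wb : CBar Ω}
    (ha : IsNeumannLaplacian Ω a wa) (hb : IsNeumannLaplacian Ω b wb) :
    dirichlet Ω a - dirichlet Ω b = -integralCLM Ω ((a - b) * (wa + wb)) := by
  obtain ⟨A, hA⟩ := ha.exists_isNeumannTriple
  obtain ⟨B, hB⟩ := hb.exists_isNeumannTriple
  have hAc := hA.continuousOn_gradient
  have hBc := hB.continuousOn_gradient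
  have hφ : IsC1UpToBoundary Ω (fun x => ext a x - ext b x)
      (fun x => InnerProductSpace.toDual ℝ _ (A x) - InnerProductSpace.toDual ℝ _ (B x)) :=
    ⟨(continuousOn_ext a).sub (continuousOn_ext b),
      ((LinearIsometryEquiv.continuous _).comp_continuousOn hAc).sub
        ((LinearIsometryEquiv.continuous _).comp_continuousOn hBc),
      fun x hx => (hA.hasGradientAt x hx).hasFDerivAt.sub (hB.hasGradientAt x hx).hasFDerivAt⟩
  have h1 := green_identity hA hφ
  have h2 := green_identity hB hφ
  simp only [sub_apply, InnerProductSpace.toDual_apply_apply] at h1 h2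
  have eD : ∀ {v : CBar Ω} {G : EuclideanSpace ℝ (Fin N) → EuclideanSpace ℝ (Fin N)},
      (∀ x ∈ Ω.carrier, HasGradientAt (ext v) (G x) x) →
      dirichlet Ω v = ∫ x in Ω.carrier, ‖G x‖ ^ 2 := fun hG =>
    setIntegral_congr_fun Ω.isOpen.measurableSet fun x hx => by
      simp only [(hG x hx).gradient]
  have hsub := (continuousOn_ext a).sub (continuousOn_ext b)
  have e2 : integralCLM Ω ((a - b) * (wa + wb))
      = (∫ x in Ω.carrier, ext wa x * (ext a x - ext b x))
        + ∫ x in Ω.carrier, ext wb x * (ext a x - ext b x) := by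
    rw [← integral_add (by exact Ω.integrableOn ((continuousOn_ext wa).mul hsub))
      (by exact Ω.integrableOn ((continuousOn_ext wb).mul hsub))]
    refine integralCLM_eq_of_eqOn _ fun x hx => ?_
    simp only [ext_apply _ (subset_closure hx), ContinuousMap.mul_apply, ContinuousMap.sub_apply,
      ContinuousMap.add_apply]
    ring
  rw [eD hA.hasGradientAt, eD hB.hasGradientAt, e2, neg_add, ← h1, ← h2,
    ← integral_sub (by exact Ω.integrableOn (hAc.norm.pow 2))
      (by exact Ω.integrableOn (hBc.norm.pow 2)),
    ← integral_add (by exact Ω.integrableOn ((hAc.inner hAc).sub (hBc.inner hAc)))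
      (by exact Ω.integrableOn ((hAc.inner hBc).sub (hBc.inner hBc)))]
  congr 1
  funext x
  rw [real_inner_self_eq_norm_sq, real_inner_self_eq_norm_sq, real_inner_comm (A x) (B x)]
  ring

lemma hasDerivAt_dirichlet {Ω : C2Domain N} {u L : ℝ → CBar Ω} {s : Set ℝ} (hs : IsOpen s)
    (hL : ContinuousOn L s) (hu : ∀ t ∈ s, IsNeumannLaplacian Ω (u t) (L t)) {t : ℝ} (ht : t ∈ s)
    {u' : CBar Ω} (hu' : HasDerivAt u u' t) :
    HasDerivAt (fun t => dirichlet Ω (u t)) (-(2 * integralCLM Ω (u' * L t))) t := by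
  rw [hasDerivAt_iff_tendsto_slope] at hu' ⊢
  have hLt : Tendsto L (𝓝[≠] t) (𝓝 (L t)) :=
    ((hL.continuousAt (hs.mem_nhds ht)).tendsto).mono_left nhdsWithin_le_nhds
  have h1 : Tendsto (fun r => -integralCLM Ω (slope u t r * (L r + L t))) (𝓝[≠] t)
      (𝓝 (-integralCLM Ω (u' * (L t + L t)))) :=
    (((integralCLM Ω).continuous.tendsto _).comp (hu'.mul (hLt.add_const _))).neg
  have h2 : integralCLM Ω (u' * (L t + L t)) = 2 * integralCLM Ω (u' * L t) := by
    rw [mul_add, map_add]; ring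
  rw [h2] at h1
  refine h1.congr' ?_
  filter_upwards [nhdsWithin_le_nhds (hs.mem_nhds ht)] with r hr
  rw [slope_def_field, dirichlet_sub_dirichlet (hu r hr) (hu t ht), slope_def_module,
    smul_mul_assoc, map_smul, smul_eq_mul]
  ring

lemma hasDerivAt_integral_mul_abs_rpow {Ω : C2Domain N} {p : ℝ} (hp : 1 < p) {u : ℝ → CBar Ω}
    {s : Set ℝ} (hs : IsOpen s) (hu : ContDiffOn ℝ 1 u s) {t : ℝ} (ht : t ∈ s) :
    HasDerivAt (fun t => ∫ x in Ω.carrier, ext (u t) x * |ext (u t) x| ^ p)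
      ((p + 1) * integralCLM Ω (absPow p (by linarith) (u t) * deriv u t)) t := by
  have hp0 : 0 ≤ p := by linarith
  have hd : ∀ r ∈ s, HasDerivAt u (deriv u r) r := fun r hr =>
    ((hu.differentiableOn one_ne_zero).differentiableAt (hs.mem_nhds hr)).hasDerivAt
  have hcu : ContinuousAt u t := (hd t ht).continuousAt
  have hcd : ContinuousAt (deriv u) t :=
    (hu.continuousOn_deriv_of_isOpen hs le_rfl).continuousAt (hs.mem_nhds ht)
  have hev : ∀ᶠ r in 𝓝 t, r ∈ s ∧ ‖u r‖ < ‖u t‖ + 1 ∧ ‖deriv u r‖ < ‖deriv u t‖ + 1 :=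
    (show ∀ᶠ r in 𝓝 t, r ∈ s from hs.mem_nhds ht).and
      ((hcu.norm.eventually (gt_mem_nhds (lt_add_one _))).and
      (hcd.norm.eventually (gt_mem_nhds (lt_add_one _))))
  have hcont : ∀ r, ContinuousOn (fun x => ext (u r) x * |ext (u r) x| ^ p) (closure Ω.carrier) :=
    fun r => (continuousOn_ext _).mul
      ((continuousOn_ext _).abs.rpow_const fun _ _ => Or.inr hp0)
  have hcont' : ContinuousOn (fun x => (p + 1) * |ext (u t) x| ^ p * ext (deriv u t) x)
      (closure Ω.carrier) :=
    (continuousOn_const.mul ((continuousOn_ext _).abs.rpow_const fun _ _ => Or.inr hp0)).mul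
      (continuousOn_ext _)
  have := (hasDerivAt_integral_of_dominated_loc_of_deriv_le
    (F := fun r x => ext (u r) x * |ext (u r) x| ^ p)
    (F' := fun r x => (p + 1) * |ext (u r) x| ^ p * ext (deriv u r) x)
    (μ := volume.restrict Ω.carrier)
    (bound := fun _ => (p + 1) * (‖u t‖ + 1) ^ p * (‖deriv u t‖ + 1)) hev
    (Eventually.of_forall fun r => (Ω.integrableOn (hcont r)).aestronglyMeasurable)
    (Ω.integrableOn (hcont t)) (Ω.integrableOn hcont').aestronglyMeasurable ?_ ?_ ?_).2
  · refine this.congr_deriv ?_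
    rw [← smul_eq_mul, ← map_smul]
    symm
    refine integralCLM_eq_of_eqOn _ fun x hx => ?_
    simp only [ext_apply _ (subset_closure hx)]
    simp [absPow, mul_assoc]
  · refine (ae_restrict_iff' Ω.isOpen.measurableSet).mpr
      (Eventually.of_forall fun x hx r hr => ?_)
    have h1 : |ext (u r) x| ≤ ‖u t‖ + 1 := by
      rw [ext_apply _ (subset_closure hx)]
      exact ((u r).norm_coe_le_norm _).trans hr.2.1.le
    have h2 : |ext (deriv u r) x| ≤ ‖deriv u t‖ + 1 := by
      rw [ext_apply _ (subset_closure hx)]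
      exact ((deriv u r).norm_coe_le_norm _).trans hr.2.2.le
    rw [norm_mul, norm_mul, Real.norm_of_nonneg (by linarith : 0 ≤ p + 1),
      Real.norm_of_nonneg (Real.rpow_nonneg (abs_nonneg _) p), Real.norm_eq_abs]
    gcongr
  · exact integrableOn_const Ω.volume_lt_top.ne
  · refine (ae_restrict_iff' Ω.isOpen.measurableSet).mpr
      (Eventually.of_forall fun x hx r hr => ?_)
    have hx' := subset_closure hx
    have h1 : HasDerivAt (fun r => ext (u r) x) (ext (deriv u r) x) r := by
      simp only [ext_apply _ hx']
      exact (ContinuousMap.evalCLM ℝ (⟨x, hx'⟩ : closure Ω.carrier)).hasFDerivAt.comp_hasDerivAt r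
        (hd r hr.1)
    exact (hasDerivAt_mul_abs_rpow hp (ext (u r) x)).comp r h1

lemma energy_eq {Ω : C2Domain N} {p : ℝ} (hp : 0 ≤ p) {v w : CBar Ω}
    (h : IsNeumannLaplacian Ω v w) : energy Ω p v
      = 1 / 2 * dirichlet Ω v - 1 / (p + 1) * ∫ x in Ω.carrier, ext v x * |ext v x| ^ p := by
  obtain ⟨G, hG⟩ := h.exists_isNeumannTriple
  have hi : IntegrableOn (fun x => ‖gradient (ext v) x‖ ^ 2) Ω.carrier :=
    (Ω.integrableOn (hG.continuousOn_gradient.norm.pow 2)).congr_fun (fun x hx => by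
      simp only [Pi.pow_apply, (hG.hasGradientAt x hx).gradient]) Ω.isOpen.measurableSet
  have hj : IntegrableOn (fun x => ext v x * |ext v x| ^ p) Ω.carrier :=
    Ω.integrableOn ((continuousOn_ext _).mul
      ((continuousOn_ext _).abs.rpow_const fun _ _ => Or.inr hp))
  rw [energy, dirichlet, integral_sub (hi.const_mul _) (hj.const_mul _), integral_const_mul,
    integral_const_mul]

/-! ### Dissipation of the energy -/

/-- The energy identity `d/dt E(u(t)) = -∫ u_t²`. The average in the equation does not contribute,
because `∫ u_t = 0`. -/
lemma IsSolution.hasDerivAt_energy {Ω : C2Domain N} {p T : ℝ} (hp : 1 < p) {u₀ : CBar Ω}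
    {u : ℝ → CBar Ω} (hu : IsSolution Ω p u₀ T u) {t : ℝ} (ht : t ∈ Ioo 0 T) :
    HasDerivAt (fun t => energy Ω p (u t)) (-integralCLM Ω (deriv u t * deriv u t)) t := by
  have hp0 : 0 ≤ p := by linarith
  obtain ⟨L, hLc, hL⟩ := hu.equation
  have hd : HasDerivAt u (deriv u t) t :=
    ((hu.contDiffOn.differentiableOn one_ne_zero).differentiableAt
      (isOpen_Ioo.mem_nhds ht)).hasDerivAt
  set P := absPow p hp0 (u t) with hP
  set c : ℝ := ⨍ y in Ω.carrier, |ext (u t) y| ^ p with hc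
  have htest : ∀ z : CBar Ω, integralCLM Ω (deriv u t * z)
      = integralCLM Ω (L t * z) + integralCLM Ω (P * z) - c * integralCLM Ω z := by
    intro z
    rw [← smul_eq_mul c, ← map_smul, ← map_add, ← map_sub]
    refine setIntegral_congr_fun Ω.isOpen.measurableSet fun x hx => ?_
    have := (hL t ht).2 x hx
    simp only [ext_apply _ (subset_closure hx)] at this ⊢
    have h1 : deriv u t ⟨x, subset_closure hx⟩
        = L t ⟨x, subset_closure hx⟩ + P ⟨x, subset_closure hx⟩ - c := by
      simp only [hP, absPow, ContinuousMap.coe_mk]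
      linarith
    simp only [ContinuousMap.mul_apply, ContinuousMap.sub_apply, ContinuousMap.add_apply,
      ContinuousMap.smul_apply, smul_eq_mul, h1]
    ring
  have hmean : integralCLM Ω (deriv u t) = 0 := by
    have h1 := htest 1
    have h2 : integralCLM Ω (1 : CBar Ω) = volume.real Ω.carrier := by
      rw [integralCLM_eq_of_eqOn (f := fun _ => 1) _ fun x hx => rfl]
      simp
    have h3 : integralCLM Ω P = c * volume.real Ω.carrier := by
      rw [hc, setAverage_eq, smul_eq_mul,
        integralCLM_eq_of_eqOn (f := fun x => |ext (u t) x| ^ p) _ fun x hx => by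
          rw [ext_apply _ (subset_closure hx)]; rfl]
      field_simp [Ω.volume_real_pos.ne']
    rw [mul_one, mul_one, mul_one, integralCLM_laplacian_eq_zero (hL t ht).1, h2, h3] at h1
    linarith
  have h1 := (hasDerivAt_dirichlet isOpen_Ioo hLc (fun r hr => (hL r hr).1) ht hd).const_mul
    (1 / 2)
  have h2 := (hasDerivAt_integral_mul_abs_rpow hp isOpen_Ioo hu.contDiffOn ht).const_mul
    (1 / (p + 1))
  have h3 : (fun r => energy Ω p (u r)) =ᶠ[𝓝 t] fun r => 1 / 2 * dirichlet Ω (u r)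
      - 1 / (p + 1) * ∫ x in Ω.carrier, ext (u r) x * |ext (u r) x| ^ p := by
    filter_upwards [isOpen_Ioo.mem_nhds ht] with r hr using energy_eq hp0 (hL r hr).1
  refine HasDerivAt.congr_of_eventuallyEq ?_ h3
  refine (h1.sub h2).congr_deriv ?_
  rw [htest (deriv u t), hmean, mul_comm (L t)]
  have : p + 1 ≠ 0 := by linarith
  field_simp
  ring

lemma eLpNorm_ext_two {Ω : C2Domain N} (v : CBar Ω) :
    eLpNorm (ext v) 2 (volume.restrict Ω.carrier)
      = ENNReal.ofReal (Real.sqrt (integralCLM Ω (v * v))) := by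
  have hm : MemLp (ext v) 2 (volume.restrict Ω.carrier) := by
    rw [memLp_two_iff_integrable_sq (integrableOn_ext v).aestronglyMeasurable]
    exact Ω.integrableOn ((continuousOn_ext v).pow 2)
  rw [hm.eLpNorm_eq_integral_rpow_norm two_ne_zero ENNReal.ofNat_ne_top, Real.sqrt_eq_rpow]
  congr 2
  · symm
    refine integralCLM_eq_of_eqOn _ fun x hx => ?_
    rw [ext_apply _ (subset_closure hx)]
    simp [sq]
  · norm_num

end NonlocalHeat

theorem theorem1p2 (N : ℕ) (hN : 1 ≤ N) (Ω : NonlocalHeat.C2Domain N) (p : ℝ) (hp : 1 < p)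
    (u₀ : NonlocalHeat.CBar Ω) (T₀ : ℝ) (hT₀ : 0 < T₀) (u : ℝ → NonlocalHeat.CBar Ω)
    (hu : NonlocalHeat.IsSolution Ω p u₀ T₀ u)
    (C₀ : ℝ) (hC₀ : 0 < C₀)
    (hE : ∀ t ∈ Set.Ioo 0 T₀, -C₀ ≤ NonlocalHeat.energy Ω p (u t)) :
    ∃ C : ℝ, 0 < C ∧ ∀ t ∈ Set.Ico 0 T₀,
      MeasureTheory.eLpNorm (NonlocalHeat.ext (u t)) 2 (MeasureTheory.volume.restrict Ω.carrier)
        ≤ ENNReal.ofReal C := by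
  let I := NonlocalHeat.integralCLM Ω
  let y : ℝ → ℝ := fun t => I (u t * u t)
  let z : ℝ → ℝ := fun t => y t + NonlocalHeat.energy Ω p (u t) + C₀
  have hyz : ∀ t ∈ Ioo 0 T₀, y t ≤ z t := fun t ht => by
    have := hE t ht
    simp only [z]
    linarith
  have hz : ∀ t ∈ Ioo 0 T₀, ∃ d, HasDerivAt z d t ∧ d ≤ z t := by
    intro t ht
    have hd : HasDerivAt u (deriv u t) t :=
      ((hu.contDiffOn.differentiableOn one_ne_zero).differentiableAt
        (isOpen_Ioo.mem_nhds ht)).hasDerivAt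
    have h1 : HasDerivAt y _ t := I.hasFDerivAt.comp_hasDerivAt t (hd.mul hd)
    refine ⟨_, (h1.add (hu.hasDerivAt_energy hp ht)).add_const C₀, le_trans ?_ (hyz t ht)⟩
    -- `2 u u_t - u_t² ≤ u²`
    have h2 : 0 ≤ I ((u t - deriv u t) * (u t - deriv u t)) :=
      NonlocalHeat.integralCLM_nonneg _ fun x => mul_self_nonneg _
    have h3 : (u t - deriv u t) * (u t - deriv u t)
        = u t * u t - (deriv u t * u t + u t * deriv u t) + deriv u t * deriv u t := by ring
    rw [h3, map_add, map_sub] at h2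
    change I _ + -I _ ≤ I _
    linarith
  have hanti : AntitoneOn (fun t => Real.exp (-t) * z t) (Ioo 0 T₀) := by
    have hg : ∀ t ∈ Ioo 0 T₀, ∃ d ≤ 0, HasDerivAt (fun t => Real.exp (-t) * z t) d t := by
      intro t ht
      obtain ⟨d, hd, hdz⟩ := hz t ht
      refine ⟨_, ?_, ((hasDerivAt_neg t).exp).mul hd⟩
      nlinarith [Real.exp_pos (-t)]
    refine antitoneOn_of_deriv_nonpos (convex_Ioo _ _) (fun t ht => ?_) (fun t ht => ?_)
      fun t ht => ?_
    · obtain ⟨d, -, hd⟩ := hg t ht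
      exact hd.continuousAt.continuousWithinAt
    · obtain ⟨d, -, hd⟩ := hg t (interior_subset ht)
      exact hd.differentiableAt.differentiableWithinAt
    · obtain ⟨d, hd0, hd⟩ := hg t (interior_subset ht)
      rwa [hd.deriv]
  have ht₀ : T₀ / 2 ∈ Ioo 0 T₀ := ⟨by linarith, by linarith⟩
  obtain ⟨M, hM⟩ := (isCompact_Icc (a := (0 : ℝ)) (b := T₀ / 2)).bddAbove_image (f := y)
    (I.continuous.comp_continuousOn
      ((hu.continuousOn.mul hu.continuousOn).mono fun t ht => ⟨ht.1, by linarith [ht.2]⟩))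
  let B : ℝ := max M (Real.exp T₀ * (Real.exp (-(T₀ / 2)) * z (T₀ / 2)))
  have hB : ∀ t ∈ Ico 0 T₀, y t ≤ B := by
    intro t ht
    rcases le_total t (T₀ / 2) with h | h
    · exact (hM ⟨t, ⟨ht.1, h⟩, rfl⟩).trans (le_max_left _ _)
    · have ht' : t ∈ Ioo 0 T₀ := ⟨by linarith, ht.2⟩
      have h0 : 0 ≤ z t := (NonlocalHeat.integralCLM_nonneg _
        fun x => mul_self_nonneg _).trans (hyz t ht')
      have h1 : Real.exp (-t) * z t ≤ Real.exp (-(T₀ / 2)) * z (T₀ / 2) := hanti ht₀ ht' h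
      refine (hyz t ht').trans (le_trans ?_ (le_max_right _ _))
      calc z t = Real.exp t * (Real.exp (-t) * z t) := by
            rw [← mul_assoc, ← Real.exp_add]; simp
        _ ≤ Real.exp T₀ * (Real.exp (-t) * z t) :=
            mul_le_mul_of_nonneg_right (Real.exp_le_exp.mpr ht.2.le) (by positivity)
        _ ≤ _ := mul_le_mul_of_nonneg_left h1 (Real.exp_pos _).le
  refine ⟨Real.sqrt B + 1, by positivity, fun t ht => ?_⟩
  rw [NonlocalHeat.eLpNorm_ext_two]
  exact ENNReal.ofReal_le_ofReal ((Real.sqrt_le_sqrt (hB t ht)).trans (by linarith))
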